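/- **Setting.** Let $T>0$, $d,n\ge1$. A $d$-sparse time-dependent Hamiltonian on $\mathbb C^n$ over $[0,T]$ is a family of Hermitian matrices $H(t)$, $t\in[0,T]$, with integrable entries, such that every row has at most $d$ entries that are nonzero at some time in $[0,T]$. Write $\|H(t)\|_{\max}=\max_{j,k}|H_{jk}(t)|$, and let $\mathcal T\exp(-i\int_0^TH(\tau)\,d\tau)$ denote the time-ordered exponential (Dyson series). A quantum algorithm accesses $H$ through the oracles $|j,k,z\rangle\mapsto|j,k,z\oplus\mathrm{col}(j,k)\rangle$, where $\mathrm{col}(j,k)$ is the column of the $k$-th possibly nonzero entry of row $j$ in increasing order (a special symbol if there is none), and $|t,j,k,z\rangle\mapsto|t,j,k,z\oplus H_{jk}(t)\rangle$, for $t$ in a finite set of times in $[0,T]$. The set of times and the (finite-length) binary encodings of the answers are chosen by the algorithm. The algorithm is a circuit $V_H=U_qOU_{q-1}O\cdots OU_0$ acting on the system $\mathbb C^n$ and an environment (query register and ancillas), with unitaries $U_0,\dots,U_q$ that do not depend on $H$, and with $q$ queries; each query $O$ may act with either oracle, or trivially, and in superposition. It *simulates $H$ over $[0,T]$ within precision $\epsilon$*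 if there is a unit vector $g$ of the environment (possibly depending on $H$) such that, for every $\psi\in\mathbb C^n$, $$\Big\|V_H(\psi\otimes|0\rangle)-\Big(\mathcal T\exp\Big(-i\int_0^TH(\tau)\,d\tau\Big)\psi\Big)\otimes g\Big\|\le\epsilon\|\psi\|.$$ **Theorem (Hard instance).** For every $A>0$ there is a constant $c>0$, depending only on $A$, such that the following holds. Let $0<\epsilon\le\frac1{16}$, $T>0$, let $d\ge2$ be an integer, and let $h:[0,T]\to[0,\infty)$ be an integrable function (the prescribed profile) with $$d\int_0^Th(\tau)\,d\tau\ \ge\ \max\big\{16\,\epsilon,\ (\log(1/\epsilon))^{-A}\big\}.$$ Then there are an $n$ and a set $\mathcal H$ of $d$-sparse time-dependent Hamiltonians on $\mathbb C^n$ over $[0,T]$, each with $\|H(t)\|_{\max}=h(t)$ for all $t\in[0,T]$ and each of the form $H(t)=h(t)\,G$ with a time-independent matrix $G$, such that every quantum algorithm that simulates each $H\in\mathcal H$ over $[0,T]$ within precision $\epsilon$ (the algorithm being given only oracle access to $H$) makes at least $$c\left(d\int_0^T\|H(\tau)\|_{\max}\,d\tau+\frac{\log(1/\epsilon)}{\log\log(1/\epsilon)}\right)$$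 queries. (For every fixed $T$, $d$ and profile with $\int_0^T h>0$, the displayed condition holds for all sufficiently small $\epsilon$; if $d\int_0^Th\ge1$, it holds for all $\epsilon\le\frac1{16}$.) Logarithms are natural. -/

import Mathlib

open MeasureTheory

noncomputable section

namespace HamSim

/-- The max-norm of a matrix: the largest absolute value of an entry. -/
def maxNorm {n : ℕ} (M : Matrix (Fin n) (Fin n) ℂ) : ℝ :=
  ⨆ p : Fin n × Fin n, ‖M p.1 p.2‖

open Classical in
/-- The columns in which row `j` of `H` is nonzero at some time of `[0, T]`. -/
def rowSupport {n : ℕ} (T : ℝ) (H : ℝ → Matrix (Fin n) (Fin n) ℂ) (j : Fin n) :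
    Finset (Fin n) :=
  Finset.univ.filter fun k => ∃ t ∈ Set.Icc (0 : ℝ) T, H t j k ≠ 0

/-- `H` is a `d`-sparse time-dependent Hamiltonian on `[0, T]`: it is Hermitian at every time, its
entries are integrable functions of time, and every row (hence every column) has at most `d`
entries that are nonzero at some time of `[0, T]`. -/
structure IsSparseHamiltonian {n : ℕ} (T : ℝ) (d : ℕ) (H : ℝ → Matrix (Fin n) (Fin n) ℂ) :
    Prop where
  hermitian : ∀ t ∈ Set.Icc (0 : ℝ) T, (H t).IsHermitian
  integrable : ∀ j k, IntervalIntegrable (fun t => H t j k) volume 0 T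
  sparse : ∀ j, (rowSupport T H j).card ≤ d

/-- The terms of the Dyson series: `D₀(t) = 1`, `Dₘ₊₁(t) = -i ∫₀ᵗ H(s) Dₘ(s) ds` (entrywise). -/
def dysonTerm {n : ℕ} (H : ℝ → Matrix (Fin n) (Fin n) ℂ) : ℕ → ℝ → Matrix (Fin n) (Fin n) ℂ
  | 0, _ => 1
  | m + 1, t => Matrix.of fun j k =>
      -Complex.I * ∫ s in (0 : ℝ)..t, (H s * dysonTerm H m s) j k

/-- The time-ordered exponential `𝒯 exp(-i ∫₀ᵀ H(τ) dτ)`, as the sum of the Dyson series. -/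
def timeOrderedExp {n : ℕ} (H : ℝ → Matrix (Fin n) (Fin n) ℂ) (T : ℝ) :
    Matrix (Fin n) (Fin n) ℂ :=
  Matrix.of fun j k => ∑' m : ℕ, dysonTerm H m T j k

/-- Bit strings of length `b`; their addition is the bitwise XOR. -/
abbrev Bits (b : ℕ) := Fin b → ZMod 2

/-- Index of the `k`-th (from `0`, in increasing order) column of `rowSupport T H j`, or `none` if
there are at most `k` such columns. -/
def col {n : ℕ} (T : ℝ) (H : ℝ → Matrix (Fin n) (Fin n) ℂ) (j : Fin n) (k : ℕ) :
    Option (Fin n) :=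
  ((rowSupport T H j).sort (· ≤ ·))[k]?

/-- Computational basis of the query register. Its three summands are: an idle state, on which a
query does nothing; the location queries `(j, k, z)`; and the value queries `(s, j, k, z)`, where
`s` names a time. -/
abbrev QueryBasis (n d times locBits valBits : ℕ) :=
  Unit ⊕ (Fin n × Fin d × Bits locBits) ⊕ (Fin times × Fin n × Fin n × Bits valBits)

instance (b : ℕ) : DecidableEq (Bits b) := inferInstance

instance (n d locBits : ℕ) : DecidableEq (Fin n × Fin d × Bits locBits) := inferInstance

instance (n times valBits : ℕ) : DecidableEq (Fin times × Fin n × Fin n × Bits valBits) :=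
  inferInstance

instance (n d times locBits valBits : ℕ) :
    DecidableEq (QueryBasis n d times locBits valBits) := inferInstance

/-- A quantum query algorithm with black-box access to a `d`-sparse Hamiltonian on `ℂⁿ` over
`[0, T]`. It fixes finitely many times at which the entries can be queried, and the binary
encodings in which the oracle writes its answers (so any finite precision is available). Its memory
consists of the system register `Fin n` and an environment made of the query register and an
ancilla register. It alternates oracle-independent unitaries with `queries` oracle calls. -/
structure QueryAlgorithm (n d : ℕ) (T : ℝ) where
  times : ℕ
  time : Fin times → Set.Icc (0 : ℝ) T
  locBits : ℕ
  encLoc : Option (Fin n) → Bits locBits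
  valBits : ℕ
  encVal : ℂ → Bits valBits
  ancilla : ℕ
  queries : ℕ
  step : ℕ → Matrix.unitaryGroup
    (Fin n × (QueryBasis n d times locBits valBits × Fin (ancilla + 1))) ℂ

namespace QueryAlgorithm

variable {n d : ℕ} {T : ℝ}

/-- Basis of the environment: query register and ancilla register. -/
abbrev Env (𝒜 : QueryAlgorithm n d T) :=
  QueryBasis n d 𝒜.times 𝒜.locBits 𝒜.valBits × Fin (𝒜.ancilla + 1)

/-- Basis of the whole memory: system register and environment. -/
abbrev Memory (𝒜 : QueryAlgorithm n d T) := Fin n × 𝒜.Env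

/-- Initial basis state of the environment. -/
def env₀ (𝒜 : QueryAlgorithm n d T) : 𝒜.Env := (Sum.inl (), 0)

/-- Action of a query on the basis of the query register:
`|j, k, z⟩ ↦ |j, k, z ⊕ col(j, k)⟩` and `|s, j, k, z⟩ ↦ |s, j, k, z ⊕ H_{jk}(tₛ)⟩`. -/
def queryMap (𝒜 : QueryAlgorithm n d T) (H : ℝ → Matrix (Fin n) (Fin n) ℂ) :
    QueryBasis n d 𝒜.times 𝒜.locBits 𝒜.valBits → QueryBasis n d 𝒜.times 𝒜.locBits 𝒜.valBits
  | Sum.inl u => Sum.inl u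
  | Sum.inr (Sum.inl (j, k, z)) => Sum.inr (Sum.inl (j, k, z + 𝒜.encLoc (col T H j k)))
  | Sum.inr (Sum.inr (s, j, k, z)) =>
      Sum.inr (Sum.inr (s, j, k, z + 𝒜.encVal (H (𝒜.time s) j k)))

/-- The oracle as a matrix on the whole memory: it permutes the basis by `queryMap` on the query
register and is the identity on the other registers. -/
def oracle (𝒜 : QueryAlgorithm n d T) (H : ℝ → Matrix (Fin n) (Fin n) ℂ) :
    Matrix 𝒜.Memory 𝒜.Memory ℂ :=
  Matrix.of fun x y => if x = (y.1, (𝒜.queryMap H y.2.1, y.2.2)) then 1 else 0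

/-- The circuit `U_q O U_{q-1} O ⋯ O U_0` after `q` queries. -/
def runFor (𝒜 : QueryAlgorithm n d T) (H : ℝ → Matrix (Fin n) (Fin n) ℂ) :
    ℕ → Matrix 𝒜.Memory 𝒜.Memory ℂ
  | 0 => (𝒜.step 0 : Matrix 𝒜.Memory 𝒜.Memory ℂ)
  | q + 1 => (𝒜.step (q + 1) : Matrix 𝒜.Memory 𝒜.Memory ℂ) * (𝒜.oracle H * 𝒜.runFor H q)

/-- The unitary that the algorithm implements when its oracle is that of `H`. -/
def run (𝒜 : QueryAlgorithm n d T) (H : ℝ → Matrix (Fin n) (Fin n) ℂ) :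
    Matrix 𝒜.Memory 𝒜.Memory ℂ :=
  𝒜.runFor H 𝒜.queries

/-- The vector `ψ ⊗ g` of the whole memory. -/
def tensor (𝒜 : QueryAlgorithm n d T) (ψ : Fin n → ℂ) (g : 𝒜.Env → ℂ) : 𝒜.Memory → ℂ :=
  fun x => ψ x.1 * g x.2

/-- The algorithm simulates `H` over `[0, T]` within precision `ε`: for some unit vector `g` of the
environment, `ψ ⊗ |env₀⟩ ↦ (𝒯 exp(-i ∫₀ᵀ H) ψ) ⊗ g` is implemented up to `ε` in operator norm. -/
def Simulates (𝒜 : QueryAlgorithm n d T) (H : ℝ → Matrix (Fin n) (Fin n) ℂ) (ε : ℝ) : Prop :=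
  ∃ g : 𝒜.Env → ℂ, ‖WithLp.toLp 2 g‖ = 1 ∧ ∀ ψ : Fin n → ℂ,
    ‖WithLp.toLp 2 ((𝒜.run H).mulVec (𝒜.tensor ψ (Pi.single 𝒜.env₀ 1)) -
      𝒜.tensor ((timeOrderedExp H T).mulVec ψ) g)‖ ≤ ε * ‖WithLp.toLp 2 ψ‖

end QueryAlgorithm

end HamSim

end

open MeasureTheory

noncomputable section

namespace HamSim

theorem integral_mul_primitive_pow {h : ℝ → ℝ} {T : ℝ} (hi : IntervalIntegrable h volume 0 T)
    (m : ℕ) {t : ℝ} (ht : t ∈ Set.Icc (0 : ℝ) T) :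
    ∫ s in (0 : ℝ)..t, h s * (∫ r in (0 : ℝ)..s, h r) ^ m
      = (∫ r in (0 : ℝ)..t, h r) ^ (m + 1) / (m + 1) := by
  have hi' : IntervalIntegrable h volume 0 t :=
    hi.mono_set (by
      rw [Set.uIcc_of_le ht.1, Set.uIcc_of_le (ht.1.trans ht.2)]
      exact Set.Icc_subset_Icc le_rfl ht.2)
  have hF : AbsolutelyContinuousOnInterval (fun s => ∫ r in (0 : ℝ)..s, h r) 0 t :=
    hi'.absolutelyContinuousOnInterval_intervalIntegral (c := 0) (by simp)
  have hP : ∀ k : ℕ, AbsolutelyContinuousOnInterval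
      (fun s => (∫ r in (0 : ℝ)..s, h r) ^ (k + 1)) 0 t := by
    intro k
    induction k with
    | zero => simpa using hF
    | succ k ih =>
      have := ih.mul hF
      simp only [pow_succ _ (k + 1)]
      exact this
  have key := (hP m).integral_deriv_eq_sub
  have hae : ∀ᵐ x, x ∈ Set.uIoc 0 t →
      deriv (fun s => (∫ r in (0 : ℝ)..s, h r) ^ (m + 1)) x
        = (m + 1 : ℝ) * (h x * (∫ r in (0 : ℝ)..x, h r) ^ m) := by
    filter_upwards [hi'.ae_hasDerivAt_integral] with x hx hxt
    have hd := (hx (Set.uIoc_subset_uIcc hxt) 0 (by simp)).pow (m + 1)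
    rw [show (fun s => (∫ r in (0 : ℝ)..s, h r) ^ (m + 1))
      = (fun s => ∫ r in (0 : ℝ)..s, h r) ^ (m + 1) from rfl, hd.deriv]
    simp only [Nat.add_sub_cancel]
    push_cast
    ring
  rw [intervalIntegral.integral_congr_ae hae, intervalIntegral.integral_const_mul] at key
  have h0 : (m + 1 : ℝ) ≠ 0 := by positivity
  rw [eq_div_iff h0, mul_comm, key]
  simp

theorem dysonTerm_smul {n : ℕ} {h : ℝ → ℝ} {T : ℝ} (hi : IntervalIntegrable h volume 0 T)
    (G : Matrix (Fin n) (Fin n) ℂ) (m : ℕ) {t : ℝ} (ht : t ∈ Set.Icc (0 : ℝ) T) :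
    dysonTerm (fun s => (h s : ℂ) • G) m t
      = (((-Complex.I * (∫ s in (0 : ℝ)..t, h s : ℝ)) ^ m) / (m.factorial : ℂ)) • G ^ m := by
  induction m generalizing t with
  | zero => simp [dysonTerm]
  | succ m ih =>
    ext j k
    have hcongr : ∀ s ∈ Set.uIcc 0 t, (((h s : ℂ) • G) * dysonTerm (fun s => (h s : ℂ) • G) m s) j k
        = ((h s * (∫ r in (0 : ℝ)..s, h r) ^ m : ℝ) : ℂ)
          * ((-Complex.I) ^ m / (m.factorial : ℂ) * (G ^ (m + 1)) j k) := by
      intro s hs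
      rw [Set.uIcc_of_le ht.1] at hs
      rw [ih ⟨hs.1, hs.2.trans ht.2⟩]
      simp only [Matrix.smul_mul, Matrix.mul_smul, Matrix.smul_apply, smul_eq_mul, ← pow_succ']
      push_cast
      ring
    simp only [dysonTerm, Matrix.of_apply]
    rw [intervalIntegral.integral_congr hcongr, intervalIntegral.integral_mul_const,
      intervalIntegral.integral_ofReal, integral_mul_primitive_pow hi m ht]
    have h1 : (m.factorial : ℂ) ≠ 0 := by exact_mod_cast m.factorial_ne_zero
    have h2 : (m + 1 : ℂ) ≠ 0 := by exact_mod_cast m.succ_ne_zero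
    simp only [Matrix.smul_apply, smul_eq_mul, Nat.factorial_succ]
    push_cast
    rw [mul_pow, pow_succ (-Complex.I)]
    field_simp

theorem timeOrderedExp_smul {n : ℕ} {h : ℝ → ℝ} {T : ℝ} (hT : 0 ≤ T)
    (hi : IntervalIntegrable h volume 0 T) (G : Matrix (Fin n) (Fin n) ℂ) :
    timeOrderedExp (fun s => (h s : ℂ) • G) T
      = NormedSpace.exp ((∫ s in (0 : ℝ)..T, h s) • (-Complex.I • G)) := by
  let _ : NormedRing (Matrix (Fin n) (Fin n) ℂ) := Matrix.linftyOpNormedRing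
  let _ : NormedAlgebra ℂ (Matrix (Fin n) (Fin n) ℂ) := Matrix.linftyOpNormedAlgebra
  ext j k
  set τ := ∫ s in (0 : ℝ)..T, h s
  have hs := NormedSpace.exp_series_hasSum_exp' (𝕂 := ℂ) (τ • (-Complex.I • G))
  have hs2 := (Pi.hasSum.mp (Pi.hasSum.mp hs j)) k
  rw [timeOrderedExp, Matrix.of_apply]
  refine (tsum_congr fun m => ?_).trans hs2.tsum_eq
  rw [dysonTerm_smul hi G m ⟨hT, le_rfl⟩, ← Complex.coe_smul, smul_smul, smul_pow]
  simp only [Matrix.smul_apply, smul_eq_mul, τ]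
  ring

theorem hasDerivAt_matrix_exp_smul_apply {n : ℕ} (B : Matrix (Fin n) (Fin n) ℂ) (t : ℝ)
    (i k : Fin n) :
    HasDerivAt (fun s : ℝ => NormedSpace.exp (s • B) i k) ((NormedSpace.exp (t • B) * B) i k) t := by
  let _ : NormedRing (Matrix (Fin n) (Fin n) ℂ) := Matrix.linftyOpNormedRing
  let _ : NormedAlgebra ℝ (Matrix (Fin n) (Fin n) ℂ) := Matrix.linftyOpNormedAlgebra
  have := hasDerivAt_exp_smul_const (𝕂 := ℝ) B t
  exact (hasDerivAt_pi.mp (hasDerivAt_pi.mp this i)) k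

theorem exp_smul_mulVec_eq {n : ℕ} (B : Matrix (Fin n) (Fin n) ℂ) (v : ℝ → Fin n → ℂ)
    (hv : ∀ t i, HasDerivAt (fun s => v s i) ((B.mulVec (v t)) i) t) (τ : ℝ) :
    (NormedSpace.exp (τ • B)).mulVec (v 0) = v τ := by
  have hconst : ∀ t : ℝ, (NormedSpace.exp (t • (-B))).mulVec (v t) = v 0 := by
    intro t
    ext i
    have hd : ∀ t : ℝ,
        HasDerivAt (fun s : ℝ => ((NormedSpace.exp (s • (-B))).mulVec (v s)) i) 0 t := by
      intro t
      have : HasDerivAt (fun s : ℝ => ∑ k, NormedSpace.exp (s • (-B)) i k * v s k)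
        (∑ k, ((NormedSpace.exp (t • (-B)) * (-B)) i k * v t k
          + NormedSpace.exp (t • (-B)) i k * (B.mulVec (v t)) k)) t :=
        HasDerivAt.fun_sum fun k _ =>
          (hasDerivAt_matrix_exp_smul_apply (-B) t i k).mul (hv t k)
      refine this.congr_deriv ?_
      rw [Finset.sum_add_distrib]
      change ((NormedSpace.exp (t • (-B)) * (-B)).mulVec (v t)) i
        + ((NormedSpace.exp (t • (-B))).mulVec (B.mulVec (v t))) i = 0
      rw [Matrix.mulVec_mulVec, Matrix.mul_neg, Matrix.neg_mulVec]
      simp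
    have := is_const_of_deriv_eq_zero (fun t => (hd t).differentiableAt) (fun t => (hd t).deriv) t 0
    simpa using this
  rw [← hconst τ, Matrix.mulVec_mulVec, smul_neg,
    ← Matrix.exp_add_of_commute _ _ (Commute.refl (τ • B)).neg_right, add_neg_cancel,
    NormedSpace.exp_zero, Matrix.one_mulVec]

theorem timeOrderedExp_mulVec_eq {n : ℕ} {h : ℝ → ℝ} {T : ℝ} (hT : 0 ≤ T)
    (hi : IntervalIntegrable h volume 0 T) (G : Matrix (Fin n) (Fin n) ℂ)
    (v : ℝ → Fin n → ℂ)
    (hv : ∀ t i, HasDerivAt (fun s => v s i) (-Complex.I * (G.mulVec (v t)) i) t) :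
    (timeOrderedExp (fun s => (h s : ℂ) • G) T).mulVec (v 0) = v (∫ s in (0 : ℝ)..T, h s) := by
  rw [timeOrderedExp_smul hT hi]
  refine exp_smul_mulVec_eq _ v (fun t i => ?_) _
  simpa [Matrix.smul_mulVec, Matrix.neg_mulVec] using hv t i

/-- The span of the functions of `N` signs that depend on at most `k` of them. -/
def lowDegree (N k : ℕ) : Submodule ℂ ((Fin N → ℤˣ) → ℂ) :=
  Submodule.span ℂ {f | ∃ S : Finset (Fin N), S.card ≤ k ∧ DependsOn f (S : Set (Fin N))}

theorem mem_lowDegree {N k : ℕ} {f : (Fin N → ℤˣ) → ℂ} {S : Finset (Fin N)} (hS : S.card ≤ k)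
    (hf : DependsOn f (S : Set (Fin N))) : f ∈ lowDegree N k :=
  Submodule.subset_span ⟨S, hS, hf⟩

theorem const_mem_lowDegree {N k : ℕ} (c : ℂ) : (fun _ => c) ∈ lowDegree N k :=
  mem_lowDegree (S := ∅) (by simp) fun _ _ _ => rfl

theorem mul_mem_lowDegree {N k l : ℕ} {f g : (Fin N → ℤˣ) → ℂ} (hf : f ∈ lowDegree N k)
    (hg : g ∈ lowDegree N l) : (fun x => f x * g x) ∈ lowDegree N (k + l) := by
  change f * g ∈ _
  induction hf using Submodule.span_induction with
  | zero => simp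
  | add f₁ f₂ _ _ h₁ h₂ => rw [add_mul]; exact add_mem h₁ h₂
  | smul c f _ h => rw [smul_mul_assoc]; exact Submodule.smul_mem _ c h
  | mem f hf =>
    obtain ⟨S, hS, hfS⟩ := hf
    induction hg using Submodule.span_induction with
    | zero => simp
    | add g₁ g₂ _ _ h₁ h₂ => rw [mul_add]; exact add_mem h₁ h₂
    | smul c g _ h => rw [mul_smul_comm]; exact Submodule.smul_mem _ c h
    | mem g hg =>
      obtain ⟨R, hR, hgR⟩ := hg
      refine mem_lowDegree (S := S ∪ R) ((Finset.card_union_le S R).trans (by omega)) ?_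
      intro x y hxy
      have h1 : f x = f y := hfS fun i hi => hxy i (by simp_all)
      have h2 : g x = g y := hgR fun i hi => hxy i (by simp_all)
      simp [h1, h2]

theorem sum_mem_lowDegree {N k : ℕ} {ι : Type*} (s : Finset ι) {f : ι → (Fin N → ℤˣ) → ℂ}
    (hf : ∀ i ∈ s, f i ∈ lowDegree N k) : (fun x => ∑ i ∈ s, f i x) ∈ lowDegree N k := by
  have := Submodule.sum_mem _ hf
  convert this using 1
  ext x
  simp

theorem star_mem_lowDegree {N k : ℕ} {f : (Fin N → ℤˣ) → ℂ} (hf : f ∈ lowDegree N k) :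
    (fun x => star (f x)) ∈ lowDegree N k := by
  change star f ∈ _
  induction hf using Submodule.span_induction with
  | zero => simp
  | add f₁ f₂ _ _ h₁ h₂ => rw [star_add]; exact add_mem h₁ h₂
  | smul c f _ h => rw [star_smul]; exact Submodule.smul_mem _ _ h
  | mem f hf =>
    obtain ⟨S, hS, hfS⟩ := hf
    exact mem_lowDegree hS fun x y hxy => congrArg star (hfS hxy)

/-- Functions of fewer than `N` of the signs are uncorrelated with the parity. -/
theorem sum_parity_mul_eq_zero {N k : ℕ} (hk : k < N) {f : (Fin N → ℤˣ) → ℂ}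
    (hf : f ∈ lowDegree N k) : ∑ x : Fin N → ℤˣ, (∏ i, ((x i : ℤ) : ℂ)) * f x = 0 := by
  induction hf using Submodule.span_induction with
  | zero => simp
  | add f₁ f₂ _ _ h₁ h₂ => simp [mul_add, Finset.sum_add_distrib, h₁, h₂]
  | smul c f _ h =>
    simp only [Pi.smul_apply, smul_eq_mul, mul_left_comm _ c]
    rw [← Finset.mul_sum, h, mul_zero]
  | mem f hf =>
    obtain ⟨S, hS, hfS⟩ := hf
    obtain ⟨i, hi⟩ : ∃ i, i ∉ S := by
      by_contra! hall
      have : S = Finset.univ := Finset.eq_univ_iff_forall.mpr hall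
      rw [this, Finset.card_univ, Fintype.card_fin] at hS
      omega
    have key := Equiv.sum_comp (Equiv.mulRight (Pi.mulSingle i (-1) : Fin N → ℤˣ))
      (fun x : Fin N → ℤˣ => (∏ i, ((x i : ℤ) : ℂ)) * f x)
    have hneg : ∀ x : Fin N → ℤˣ,
        (∏ j, (((x * Pi.mulSingle i (-1) : Fin N → ℤˣ) j : ℤ) : ℂ)) * f (x * Pi.mulSingle i (-1))
          = -((∏ i, ((x i : ℤ) : ℂ)) * f x) := by
      intro x
      have h1 : f (x * Pi.mulSingle i (-1)) = f x := hfS fun j hj => by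
        have : j ≠ i := fun h => hi (h ▸ hj)
        simp [this]
      rw [h1]
      have h3 : ∏ j, (((Pi.mulSingle i (-1) : Fin N → ℤˣ) j : ℤ) : ℂ) = -1 := by
        rw [Finset.prod_eq_single i]
        · simp
        · intro j _ hj
          simp [hj]
        · simp
      simp only [Pi.mul_apply, Units.val_mul, Int.cast_mul, Finset.prod_mul_distrib, h3]
      ring
    simp only [Equiv.coe_mulRight, hneg, Finset.sum_neg_distrib] at key
    have h2 : (2 : ℂ) * ∑ x : Fin N → ℤˣ, (∏ i, ((x i : ℤ) : ℂ)) * f x = 0 := by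
      linear_combination -key
    simpa using h2

theorem runFor_mem_lowDegree {n d N : ℕ} {T : ℝ} (𝒜 : QueryAlgorithm n d T)
    (H : (Fin N → ℤˣ) → ℝ → Matrix (Fin n) (Fin n) ℂ)
    (hcol : ∀ x y j k, col T (H x) j k = col T (H y) j k)
    (hval : ∀ j k, ∃ S : Finset (Fin N), S.card ≤ 1 ∧
      ∀ t ∈ Set.Icc (0 : ℝ) T, DependsOn (fun x => H x t j k) (S : Set (Fin N)))
    (p : ℕ) (a b : 𝒜.Memory) : (fun x => 𝒜.runFor (H x) p a b) ∈ lowDegree N p := by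
  induction p generalizing a b with
  | zero => exact const_mem_lowDegree _
  | succ p ih =>
    have horacle : ∀ a c : 𝒜.Memory, (fun x => 𝒜.oracle (H x) a c) ∈ lowDegree N 1 := by
      rintro a ⟨c₁, c₂, c₃⟩
      obtain ⟨S, hS, hmap⟩ : ∃ S : Finset (Fin N), S.card ≤ 1 ∧
          DependsOn (fun x => 𝒜.queryMap (H x) c₂) (S : Set (Fin N)) := by
        rcases c₂ with u | ⟨j, k, z⟩ | ⟨s, j, k, z⟩
        · exact ⟨∅, by simp, fun _ _ _ => rfl⟩
        · refine ⟨∅, by simp, fun x y _ => ?_⟩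
          simp only [QueryAlgorithm.queryMap, hcol x y]
        · obtain ⟨S, hS, hd⟩ := hval j k
          refine ⟨S, hS, fun x y hxy => ?_⟩
          have := hd _ (𝒜.time s).2 hxy
          simp only [QueryAlgorithm.queryMap] at this ⊢
          rw [this]
      refine mem_lowDegree hS fun x y hxy => ?_
      have := hmap hxy
      simp only at this
      simp only [QueryAlgorithm.oracle, Matrix.of_apply, this]
    simp only [QueryAlgorithm.runFor, Matrix.mul_apply]
    refine sum_mem_lowDegree _ fun c _ => ?_
    have h1 : (fun x => ∑ e, 𝒜.oracle (H x) c e * 𝒜.runFor (H x) p e b) ∈ lowDegree N (1 + p) :=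
      sum_mem_lowDegree _ fun e _ => mul_mem_lowDegree (horacle c e) (ih e b)
    rw [add_comm] at h1
    exact Submodule.smul_mem _ ((𝒜.step (p + 1) : Matrix 𝒜.Memory 𝒜.Memory ℂ) a c) h1

/-- The vector `(⟨a| ⊗ 1) Φ`. -/
def contract {ι κ : Type*} [Fintype ι] (a : ι → ℂ) (Φ : ι × κ → ℂ) (y : κ) : ℂ :=
  ∑ i, star (a i) * Φ (i, y)

theorem norm_contract_le {ι κ : Type*} [Fintype ι] [Fintype κ] (a : ι → ℂ) (Φ : ι × κ → ℂ) :
    ‖WithLp.toLp 2 (contract a Φ)‖ ≤ ‖WithLp.toLp 2 a‖ * ‖WithLp.toLp 2 Φ‖ := by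
  have hsq : ‖WithLp.toLp 2 (contract a Φ)‖ ^ 2 ≤
      (‖WithLp.toLp 2 a‖ * ‖WithLp.toLp 2 Φ‖) ^ 2 := by
    rw [mul_pow, EuclideanSpace.norm_sq_eq, EuclideanSpace.norm_sq_eq (WithLp.toLp 2 Φ),
      Fintype.sum_prod_type_right, Finset.mul_sum]
    refine Finset.sum_le_sum fun y _ => ?_
    have h1 : contract a Φ y = inner ℂ (WithLp.toLp 2 a) (WithLp.toLp 2 fun i => Φ (i, y)) := by
      simp [contract, PiLp.inner_apply, mul_comm]
    have h2 := norm_inner_le_norm (𝕜 := ℂ) (WithLp.toLp 2 a) (WithLp.toLp 2 fun i => Φ (i, y))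
    rw [← h1] at h2
    calc ‖contract a Φ y‖ ^ 2 ≤ (‖WithLp.toLp 2 a‖ * ‖WithLp.toLp 2 fun i => Φ (i, y)‖) ^ 2 :=
          pow_le_pow_left₀ (norm_nonneg _) h2 2
      _ = _ := by rw [mul_pow, EuclideanSpace.norm_sq_eq (WithLp.toLp 2 fun i => Φ (i, y))]
  exact le_of_sq_le_sq hsq (by positivity)

theorem norm_inner_sub_inner_le {E : Type*} [NormedAddCommGroup E] [InnerProductSpace ℂ E]
    {α β α' β' : E} {δ : ℝ} (h1 : ‖α - α'‖ ≤ δ) (h2 : ‖β - β'‖ ≤ δ) :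
    ‖inner ℂ α β - inner ℂ α' β'‖ ≤ δ * (‖α'‖ + ‖β'‖ + δ) := by
  have h : inner ℂ α β - inner ℂ α' β' = inner ℂ (α - α') β' + inner ℂ α' (β - β')
      + inner ℂ (α - α') (β - β') := by
    simp only [inner_sub_left, inner_sub_right]; ring
  have hδ : 0 ≤ δ := (norm_nonneg _).trans h1
  rw [h]
  refine (norm_add₃_le ..).trans ?_
  have e1 := norm_inner_le_norm (𝕜 := ℂ) (α - α') β'
  have e2 := norm_inner_le_norm (𝕜 := ℂ) α' (β - β')
  have e3 := norm_inner_le_norm (𝕜 := ℂ) (α - α') (β - β')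
  have f1 : ‖α - α'‖ * ‖β'‖ ≤ δ * ‖β'‖ := by gcongr
  have f2 : ‖α'‖ * ‖β - β'‖ ≤ ‖α'‖ * δ := by gcongr
  have f3 : ‖α - α'‖ * ‖β - β'‖ ≤ δ * δ := by gcongr
  linarith

theorem QueryAlgorithm.Simulates.norm_correlation_sub_le {n d : ℕ} {T ε : ℝ}
    {𝒜 : QueryAlgorithm n d T} {H : ℝ → Matrix (Fin n) (Fin n) ℂ} (hsim : 𝒜.Simulates H ε)
    {ψ a b : Fin n → ℂ} (ha : ‖WithLp.toLp 2 a‖ = 1) (hb : ‖WithLp.toLp 2 b‖ = 1)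
    (hza : ‖∑ i, star (a i) * (timeOrderedExp H T).mulVec ψ i‖ ≤ 1)
    (hzb : ‖∑ i, star (b i) * (timeOrderedExp H T).mulVec ψ i‖ ≤ 1) :
    ‖∑ y, star (contract a ((𝒜.run H).mulVec (𝒜.tensor ψ (Pi.single 𝒜.env₀ 1))) y)
        * contract b ((𝒜.run H).mulVec (𝒜.tensor ψ (Pi.single 𝒜.env₀ 1))) y
      - star (∑ i, star (a i) * (timeOrderedExp H T).mulVec ψ i)
        * ∑ i, star (b i) * (timeOrderedExp H T).mulVec ψ i‖
      ≤ (ε * ‖WithLp.toLp 2 ψ‖) * (2 + ε * ‖WithLp.toLp 2 ψ‖) := by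
  obtain ⟨g, hg, hs⟩ := hsim
  set Ψ := (𝒜.run H).mulVec (𝒜.tensor ψ (Pi.single 𝒜.env₀ 1))
  set u := (timeOrderedExp H T).mulVec ψ
  set δ := ε * ‖WithLp.toLp 2 ψ‖
  have hbd : ∀ c : Fin n → ℂ, ‖WithLp.toLp 2 c‖ = 1 →
      ‖WithLp.toLp 2 (contract c Ψ) - WithLp.toLp 2 ((∑ i, star (c i) * u i) • g)‖ ≤ δ := by
    intro c hc
    have h1 : WithLp.toLp 2 (contract c Ψ) - WithLp.toLp 2 ((∑ i, star (c i) * u i) • g)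
        = WithLp.toLp 2 (contract c (Ψ - 𝒜.tensor u g)) := by
      rw [← WithLp.toLp_sub]
      congr 1
      ext y
      simp only [contract, QueryAlgorithm.tensor, Pi.sub_apply, Pi.smul_apply, smul_eq_mul, mul_sub,
        Finset.sum_sub_distrib, Finset.sum_mul, mul_assoc]
    rw [h1]
    refine (norm_contract_le _ _).trans ?_
    rw [hc, one_mul]
    exact hs ψ
  have hin := norm_inner_sub_inner_le (hbd a ha) (hbd b hb)
  have e1 : ∀ α β : 𝒜.Env → ℂ, inner ℂ (WithLp.toLp 2 α) (WithLp.toLp 2 β)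
      = ∑ y, star (α y) * β y := by
    intro α β
    simp [PiLp.inner_apply, mul_comm]
  have hδ : 0 ≤ δ := (norm_nonneg _).trans (hbd a ha)
  rw [e1, WithLp.toLp_smul, WithLp.toLp_smul, inner_smul_left, inner_smul_right,
    inner_self_eq_norm_sq_to_K, hg, norm_smul, norm_smul, hg] at hin
  simp only [one_pow, mul_one, RCLike.ofReal_one] at hin
  refine hin.trans ?_
  gcongr
  linarith

/-- If a signed family of Hamiltonians transports the amplitude `z · ∏ᵢ xᵢ`, then a simulation
with fewer than `N / 2` queries forces `z` to be small. -/
theorem norm_amplitude_le {n d N : ℕ} {T ε : ℝ} (hε : 0 < ε) (hε' : ε ≤ 1 / 16)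
    (𝒜 : QueryAlgorithm n d T)
    (H : (Fin N → ℤˣ) → ℝ → Matrix (Fin n) (Fin n) ℂ)
    (hcol : ∀ x y j k, col T (H x) j k = col T (H y) j k)
    (hval : ∀ j k, ∃ S : Finset (Fin N), S.card ≤ 1 ∧
      ∀ t ∈ Set.Icc (0 : ℝ) T, DependsOn (fun x => H x t j k) (S : Set (Fin N)))
    (hsim : ∀ x, 𝒜.Simulates (H x) ε)
    {ψ a b : Fin n → ℂ} (hψ : ‖WithLp.toLp 2 ψ‖ = √2)
    (ha : ‖WithLp.toLp 2 a‖ = 1) (hb : ‖WithLp.toLp 2 b‖ = 1) {w z : ℂ} (hw : ‖w‖ = 1)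
    (hz : ‖z‖ ≤ 1)
    (hza : ∀ x, ∑ i, star (a i) * (timeOrderedExp (H x) T).mulVec ψ i = w)
    (hzb : ∀ x, ∑ i, star (b i) * (timeOrderedExp (H x) T).mulVec ψ i = (∏ i, ((x i : ℤ) : ℂ)) * z)
    (hq : 2 * 𝒜.queries < N) : ‖z‖ ≤ 4 * ε := by
  set f : (Fin N → ℤˣ) → ℂ := fun x =>
    ∑ y, star (contract a ((𝒜.run (H x)).mulVec (𝒜.tensor ψ (Pi.single 𝒜.env₀ 1))) y)
        * contract b ((𝒜.run (H x)).mulVec (𝒜.tensor ψ (Pi.single 𝒜.env₀ 1))) y with hf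
  have hamp : ∀ (c : Fin n → ℂ) y, (fun x => contract c ((𝒜.run (H x)).mulVec
      (𝒜.tensor ψ (Pi.single 𝒜.env₀ 1))) y) ∈ lowDegree N 𝒜.queries := by
    intro c y
    refine sum_mem_lowDegree _ fun i _ => Submodule.smul_mem _ (star (c i)) ?_
    refine sum_mem_lowDegree _ fun e _ => ?_
    have := runFor_mem_lowDegree 𝒜 H hcol hval 𝒜.queries (i, y) e
    have := Submodule.smul_mem _ (𝒜.tensor ψ (Pi.single 𝒜.env₀ 1) e) this
    convert this using 1
    ext x
    exact mul_comm _ _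
  have hfl : f ∈ lowDegree N (𝒜.queries + 𝒜.queries) :=
    sum_mem_lowDegree _ fun y _ => mul_mem_lowDegree (star_mem_lowDegree (hamp a y)) (hamp b y)
  have h0 := sum_parity_mul_eq_zero (by omega) hfl
  have hp : ∀ x : Fin N → ℤˣ, (∏ i, ((x i : ℤ) : ℂ)) * (∏ i, ((x i : ℤ) : ℂ)) = 1 := by
    intro x
    rw [← Finset.prod_mul_distrib]
    refine Finset.prod_eq_one fun i _ => ?_
    rcases Int.units_eq_one_or (x i) with h | h <;> simp [h]
  have hpn : ∀ x : Fin N → ℤˣ, ‖∏ i, ((x i : ℤ) : ℂ)‖ = 1 := by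
    intro x
    rw [norm_prod]
    refine Finset.prod_eq_one fun i _ => ?_
    rcases Int.units_eq_one_or (x i) with h | h <;> simp [h]
  have h2 : √2 ≤ 1.42 := by
    rw [Real.sqrt_le_left (by norm_num)]; norm_num
  have h2' : 0 ≤ √2 := Real.sqrt_nonneg 2
  have hbd : ∀ x, ‖f x - star w * ((∏ i, ((x i : ℤ) : ℂ)) * z)‖ ≤ 4 * ε := by
    intro x
    have := (hsim x).norm_correlation_sub_le (ψ := ψ) ha hb (by rw [hza, hw])
      (by rw [hzb, norm_mul, hpn, one_mul]; exact hz)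
    rw [hza, hzb, hψ] at this
    refine this.trans ?_
    have h3 : ε * √2 ≤ ε * 1.42 := by gcongr
    have h4 : ε * √2 ≤ 0.1 := by nlinarith
    nlinarith [mul_nonneg hε.le h2']
  have hsum : ∑ x : Fin N → ℤˣ, (∏ i, ((x i : ℤ) : ℂ)) * (f x - star w * ((∏ i, ((x i : ℤ) : ℂ)) * z))
      = -((Fintype.card (Fin N → ℤˣ) : ℂ) * (star w * z)) := by
    simp only [mul_sub, Finset.sum_sub_distrib, h0]
    have : ∀ x : Fin N → ℤˣ, (∏ i, ((x i : ℤ) : ℂ)) * (star w * ((∏ i, ((x i : ℤ) : ℂ)) * z))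
        = star w * z := fun x => by linear_combination (star w * z) * hp x
    simp only [this, zero_sub, Finset.sum_const, Finset.card_univ, nsmul_eq_mul]
  have hle := (norm_sum_le Finset.univ fun x : Fin N → ℤˣ =>
    (∏ i, ((x i : ℤ) : ℂ)) * (f x - star w * ((∏ i, ((x i : ℤ) : ℂ)) * z))).trans
    (Finset.sum_le_card_nsmul _ _ (4 * ε) fun x _ => by
      rw [norm_mul, hpn, one_mul]; exact hbd x)
  rw [hsum, norm_neg, norm_mul, norm_mul, norm_star, hw, one_mul, Finset.card_univ, nsmul_eq_mul,
    Complex.norm_natCast] at hle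
  exact le_of_mul_le_mul_left hle (by exact_mod_cast Fintype.card_pos)

/-- Off-diagonal entries `√((j + 1) (N - j))` of the angular momentum operator `2 Jₓ`. -/
def spinWeight (N j : ℕ) : ℝ := √((j + 1 : ℝ) * (N - j))

theorem spinWeight_self (N : ℕ) : spinWeight N N = 0 := by simp [spinWeight]

theorem spinWeight_le {N j : ℕ} (hj : j < N) : spinWeight N j ≤ N := by
  have h1 : (j + 1 : ℝ) ≤ N := by exact_mod_cast hj
  have h0 : (0 : ℝ) ≤ j := by positivity
  refine Real.sqrt_le_iff.mpr ⟨by positivity, ?_⟩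
  nlinarith

theorem spinWeight_mul_sqrt_choose_succ {N j : ℕ} (hj : j ≤ N) :
    spinWeight N j * √(N.choose (j + 1)) = (N - j : ℝ) * √(N.choose j) := by
  have h1 : (0 : ℝ) ≤ N - j := by
    have : (j : ℝ) ≤ N := by exact_mod_cast hj
    linarith
  have h2 : (N.choose (j + 1) : ℝ) * (j + 1) = N.choose j * (N - j) := by
    rw [← Nat.cast_sub hj]
    exact_mod_cast N.choose_succ_right_eq j
  rw [spinWeight, ← Real.sqrt_mul (by positivity), ← Real.sqrt_sq h1, ← Real.sqrt_mul (by positivity),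
    Real.sqrt_sq h1]
  congr 1
  linear_combination (N - j : ℝ) * h2

theorem spinWeight_mul_sqrt_choose {N j : ℕ} (hj : j ≤ N) :
    spinWeight N j * √(N.choose j) = (j + 1 : ℝ) * √(N.choose (j + 1)) := by
  have h1 : (0 : ℝ) ≤ N - j := by
    have : (j : ℝ) ≤ N := by exact_mod_cast hj
    linarith
  have h3 : (0 : ℝ) ≤ j + 1 := by positivity
  have h2 : (N.choose (j + 1) : ℝ) * (j + 1) = N.choose j * (N - j) := by
    rw [← Nat.cast_sub hj]
    exact_mod_cast N.choose_succ_right_eq j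
  rw [spinWeight, ← Real.sqrt_mul (by positivity), ← Real.sqrt_sq h3, ← Real.sqrt_mul (by positivity),
    Real.sqrt_sq h3]
  congr 1
  linear_combination -(j + 1 : ℝ) * h2

/-- Amplitudes of the rotated spin state `exp(-iθ · 2Jₓ) e₀`. -/
def spinAmp (N j : ℕ) (θ : ℝ) : ℂ :=
  (√(N.choose j) : ℝ) * (Real.cos θ : ℂ) ^ (N - j) * (-Complex.I * (Real.sin θ : ℂ)) ^ j

theorem hasDerivAt_ofReal_cos (θ : ℝ) :
    HasDerivAt (fun θ : ℝ => (Real.cos θ : ℂ)) (-(Real.sin θ : ℂ)) θ := by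
  simpa using (Real.hasDerivAt_cos θ).ofReal_comp

theorem hasDerivAt_ofReal_sin (θ : ℝ) :
    HasDerivAt (fun θ : ℝ => (Real.sin θ : ℂ)) (Real.cos θ : ℂ) θ :=
  (Real.hasDerivAt_sin θ).ofReal_comp

theorem spinWeight_mul_spinAmp_succ {N j : ℕ} (hj : j ≤ N) (θ : ℝ) :
    (spinWeight N j : ℂ) * spinAmp N (j + 1) θ
      = (√(N.choose j) : ℝ) * (((N - j : ℕ) : ℂ) * (Real.cos θ : ℂ) ^ (N - j - 1)
        * (-Complex.I * (Real.sin θ : ℂ)) ^ (j + 1)) := by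
  have h : (spinWeight N j : ℂ) * (√(N.choose (j + 1)) : ℝ) = ((N - j : ℕ) : ℂ) * (√(N.choose j) : ℝ) := by
    rw [Nat.cast_sub hj]
    exact_mod_cast congrArg (fun r : ℝ => (r : ℂ)) (spinWeight_mul_sqrt_choose_succ hj)
  rw [spinAmp, ← Nat.sub_sub]
  linear_combination (Real.cos θ : ℂ) ^ (N - j - 1) * (-Complex.I * (Real.sin θ : ℂ)) ^ (j + 1) * h

theorem spinWeight_mul_spinAmp {N j : ℕ} (hj : j < N) (θ : ℝ) :
    (spinWeight N j : ℂ) * spinAmp N j θ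
      = (√(N.choose (j + 1)) : ℝ) * (((j + 1 : ℕ) : ℂ) * (Real.cos θ : ℂ) ^ (N - (j + 1) + 1)
        * (-Complex.I * (Real.sin θ : ℂ)) ^ j) := by
  have h : (spinWeight N j : ℂ) * (√(N.choose j) : ℝ)
      = ((j + 1 : ℕ) : ℂ) * (√(N.choose (j + 1)) : ℝ) := by
    push_cast
    exact_mod_cast congrArg (fun r : ℝ => (r : ℂ)) (spinWeight_mul_sqrt_choose hj.le)
  rw [spinAmp, show N - j = N - (j + 1) + 1 by omega]
  linear_combination (Real.cos θ : ℂ) ^ (N - (j + 1) + 1) * (-Complex.I * (Real.sin θ : ℂ)) ^ j * h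

theorem hasDerivAt_spinAmp_zero (N : ℕ) (θ : ℝ) :
    HasDerivAt (spinAmp N 0) (-Complex.I * (spinWeight N 0 * spinAmp N 1 θ)) θ := by
  have h := ((hasDerivAt_ofReal_cos θ).pow N).const_mul ((√(N.choose 0) : ℝ) : ℂ)
  have e : spinAmp N 0 = fun θ => ((√(N.choose 0) : ℝ) : ℂ) * ((fun θ : ℝ => (Real.cos θ : ℂ)) ^ N) θ := by
    ext θ; simp [spinAmp]
  rw [e]
  refine h.congr_deriv ?_
  rw [spinWeight_mul_spinAmp_succ N.zero_le]
  simp only [Nat.sub_zero, zero_add, pow_one]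
  linear_combination (-((√(N.choose 0) : ℝ) : ℂ) * N * (Real.cos θ : ℂ) ^ (N - 1) * (Real.sin θ : ℂ)) * Complex.I_mul_I

theorem hasDerivAt_spinAmp_succ {N j : ℕ} (hj : j < N) (θ : ℝ) :
    HasDerivAt (spinAmp N (j + 1)) (-Complex.I * (spinWeight N (j + 1) * spinAmp N (j + 2) θ
      + spinWeight N j * spinAmp N j θ)) θ := by
  have h := (((hasDerivAt_ofReal_cos θ).pow (N - (j + 1))).const_mul
    ((√(N.choose (j + 1)) : ℝ) : ℂ)).mul (((hasDerivAt_ofReal_sin θ).const_mul (-Complex.I)).pow (j + 1))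
  refine h.congr_deriv ?_
  rw [spinWeight_mul_spinAmp_succ hj, spinWeight_mul_spinAmp hj]
  simp only [Pi.pow_apply, Nat.add_sub_cancel]
  rw [pow_succ (-Complex.I * (Real.sin θ : ℂ)) (j + 1)]
  generalize (-Complex.I * (Real.sin θ : ℂ)) ^ (j + 1) = w
  linear_combination (-((√(N.choose (j + 1)) : ℝ) : ℂ) * ((N - (j + 1) : ℕ) : ℂ)
    * (Real.cos θ : ℂ) ^ (N - (j + 1) - 1) * w
    * (Real.sin θ : ℂ)) * Complex.I_mul_I

/-- The sign at position `j`, extended by `1` beyond `N`. -/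
def signAt {N : ℕ} (x : Fin N → ℤˣ) (j : ℕ) : ℂ := if h : j < N then ((x ⟨j, h⟩ : ℤ) : ℂ) else 1

theorem signAt_mul_self {N : ℕ} (x : Fin N → ℤˣ) (j : ℕ) : signAt x j * signAt x j = 1 := by
  unfold signAt
  split_ifs with h
  · rcases Int.units_eq_one_or (x ⟨j, h⟩) with h | h <;> simp [h]
  · simp

theorem norm_signAt {N : ℕ} (x : Fin N → ℤˣ) (j : ℕ) : ‖signAt x j‖ = 1 := by
  unfold signAt
  split_ifs with h
  · rcases Int.units_eq_one_or (x ⟨j, h⟩) with h | h <;> simp [h]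
  · simp

theorem star_signAt {N : ℕ} (x : Fin N → ℤˣ) (j : ℕ) : star (signAt x j) = signAt x j := by
  unfold signAt
  split_ifs with h <;> simp

theorem dependsOn_signAt {N : ℕ} (j : ℕ) : ∃ S : Finset (Fin N), S.card ≤ 1 ∧
    DependsOn (fun x : Fin N → ℤˣ => signAt x j) (S : Set (Fin N)) := by
  by_cases h : j < N
  · refine ⟨{⟨j, h⟩}, by simp, fun x y hxy => ?_⟩
    have := hxy ⟨j, h⟩ (by simp)
    simp [signAt, h, this]
  · exact ⟨∅, by simp, fun x y _ => by simp [signAt, h]⟩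

theorem prod_range_signAt {N : ℕ} (x : Fin N → ℤˣ) :
    ∏ j ∈ Finset.range N, signAt x j = ∏ i, ((x i : ℤ) : ℂ) := by
  rw [Finset.prod_range]
  exact Finset.prod_congr rfl fun i _ => by simp [signAt]

/-- Entries of the signed weighted path. -/
def pathEntry {N : ℕ} (m : ℕ) (ω : ℝ) (x : Fin N → ℤˣ) (j k : ℕ) : ℂ :=
  if k = j + 1 then signAt x j * (ω * spinWeight N j / m : ℝ)
  else if j = k + 1 then signAt x k * (ω * spinWeight N k / m : ℝ) else 0

theorem star_pathEntry {N : ℕ} (m : ℕ) (ω : ℝ) (x : Fin N → ℤˣ) (j k : ℕ) :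
    star (pathEntry m ω x j k) = pathEntry m ω x k j := by
  unfold pathEntry
  by_cases h1 : k = j + 1
  · have h2 : ¬ j = k + 1 := by omega
    rw [if_pos h1, if_neg h2, if_pos h1, star_mul', star_signAt]
    simp
  · by_cases h2 : j = k + 1
    · rw [if_neg h1, if_pos h2, if_pos h2, star_mul', star_signAt]
      simp
    · rw [if_neg h1, if_neg h2, if_neg h2, if_neg h1, star_zero]

theorem norm_pathEntry_eq {N : ℕ} (m : ℕ) (ω : ℝ) (x y : Fin N → ℤˣ) (j k : ℕ) :
    ‖pathEntry m ω x j k‖ = ‖pathEntry m ω y j k‖ := by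
  unfold pathEntry
  split_ifs <;> simp [norm_signAt]

theorem norm_pathEntry_le {N m : ℕ} {ω : ℝ} (hm : 0 < m) (hω : 0 ≤ ω) (hωm : N * ω ≤ m)
    (x : Fin N → ℤˣ) {j k : ℕ} (hj : j ≤ N) (hk : k ≤ N) : ‖pathEntry m ω x j k‖ ≤ 1 := by
  have key : ∀ i, i < N → ‖signAt x i * (ω * spinWeight N i / m : ℝ)‖ ≤ 1 := by
    intro i hi
    have h0 : 0 ≤ spinWeight N i := Real.sqrt_nonneg _
    have hm' : (0 : ℝ) < m := by exact_mod_cast hm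
    rw [norm_mul, norm_signAt, one_mul, Complex.norm_real, Real.norm_of_nonneg (by positivity),
      div_le_one hm']
    have := spinWeight_le hi
    nlinarith
  unfold pathEntry
  split_ifs with h1 h2
  · exact key j (by omega)
  · exact key k (by omega)
  · simp

theorem dependsOn_pathEntry {N : ℕ} (m : ℕ) (ω : ℝ) (j k : ℕ) : ∃ S : Finset (Fin N), S.card ≤ 1 ∧
    DependsOn (fun x : Fin N → ℤˣ => pathEntry m ω x j k) (S : Set (Fin N)) := by
  by_cases h1 : k = j + 1
  · obtain ⟨S, hS, hd⟩ := dependsOn_signAt (N := N) j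
    refine ⟨S, hS, fun x y hxy => ?_⟩
    have : signAt x j = signAt y j := hd hxy
    simp [pathEntry, this, h1]
  · obtain ⟨S, hS, hd⟩ := dependsOn_signAt (N := N) k
    refine ⟨S, hS, fun x y hxy => ?_⟩
    have : signAt x k = signAt y k := hd hxy
    simp [pathEntry, this, h1]

/-- Amplitudes of the walk on the signed path started at its first vertex. -/
def pathAmp {N : ℕ} (ω : ℝ) (x : Fin N → ℤˣ) (t : ℝ) (j : ℕ) : ℂ :=
  (∏ i ∈ Finset.range j, signAt x i) * spinAmp N j (ω * t)

theorem sum_pathEntry_mul {N : ℕ} (m : ℕ) (ω : ℝ) (x : Fin N → ℤˣ) (u : ℕ → ℂ) {j : ℕ}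
    (hj : j ≤ N) : ∑ k ∈ Finset.range (N + 1), pathEntry m ω x j k * u k
      = signAt x j * (ω * spinWeight N j / m : ℝ) * u (j + 1)
        + (if j = 0 then 0 else signAt x (j - 1) * (ω * spinWeight N (j - 1) / m : ℝ) * u (j - 1)) := by
  have h1 : ∀ k, pathEntry m ω x j k * u k
      = (if k = j + 1 then signAt x j * (ω * spinWeight N j / m : ℝ) * u (j + 1) else 0)
        + (if k = j - 1 then (if j = 0 then 0 else
          signAt x (j - 1) * (ω * spinWeight N (j - 1) / m : ℝ) * u (j - 1)) else 0) := by
    intro k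
    unfold pathEntry
    by_cases h1 : k = j + 1
    · subst h1; simp [show j + 1 ≠ j - 1 by omega]
    · by_cases h2 : j = k + 1
      · subst h2
        have h3 : k ≠ k + 1 + 1 := by omega
        simp [h3]
      · have : ¬ (k = j - 1 ∧ j ≠ 0) := by omega
        by_cases h0 : j = 0
        · simp [h0] at h1 ⊢; simp [h1]
        · have h4 : k ≠ j - 1 := by omega
          simp [h1, h2, h4]
  rw [Finset.sum_congr rfl fun k _ => h1 k, Finset.sum_add_distrib, Finset.sum_ite_eq',
    Finset.sum_ite_eq']
  congr 1
  · split_ifs with h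
    · rfl
    · have : j = N := by simp at h; omega
      subst this
      simp [spinWeight_self]
  · rw [if_pos (by simp; omega)]

theorem hasDerivAt_pathAmp {N m : ℕ} (hm : 0 < m) (ω : ℝ) (x : Fin N → ℤˣ) (t : ℝ) {j : ℕ}
    (hj : j ≤ N) : HasDerivAt (fun t => pathAmp ω x t j)
      (-Complex.I * (m * ∑ k ∈ Finset.range (N + 1), pathEntry m ω x j k * pathAmp ω x t k)) t := by
  have hm' : (m : ℂ) ≠ 0 := by exact_mod_cast hm.ne'
  have hmul : HasDerivAt (fun t : ℝ => ω * t) ω t := by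
    simpa using (hasDerivAt_id t).const_mul ω
  rw [sum_pathEntry_mul m ω x _ hj]
  rcases j with _ | j
  · have h := (hasDerivAt_spinAmp_zero N (ω * t)).scomp t hmul
    have e : (fun t => pathAmp ω x t 0) = spinAmp N 0 ∘ fun t => ω * t := by
      ext t; simp [pathAmp]
    rw [e]
    refine h.congr_deriv ?_
    simp only [pathAmp, zero_add, Finset.prod_range_one, if_true, add_zero, Complex.real_smul]
    push_cast
    field_simp
    linear_combination (ω : ℂ) * spinWeight N 0 * spinAmp N 1 (ω * t) * signAt_mul_self x 0
  · have h := ((hasDerivAt_spinAmp_succ hj (ω * t)).scomp t hmul).const_mul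
      (∏ i ∈ Finset.range (j + 1), signAt x i)
    refine h.congr_deriv ?_
    simp only [pathAmp, Finset.prod_range_succ, Nat.succ_ne_zero, if_false, Complex.real_smul,
      Nat.add_sub_cancel]
    push_cast
    generalize ∏ i ∈ Finset.range j, signAt x i = P
    field_simp
    linear_combination P * signAt x j * ω * spinWeight N (j + 1) * spinAmp N (j + 2) (ω * t)
      * signAt_mul_self x (j + 1)

/-- Vertices: `m` copies of each vertex of a path of length `N`, and one isolated vertex. -/
abbrev Vertex (N m : ℕ) := (Fin (N + 1) × Fin m) ⊕ Unit

/-- The number of vertices. -/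
abbrev dim (N m : ℕ) : ℕ := Fintype.card (Vertex N m)

/-- The numbering of the vertices. -/
def vertexEquiv (N m : ℕ) : Fin (dim N m) ≃ Vertex N m := (Fintype.equivFin _).symm

/-- The signed blown-up path together with a self-loop of weight `1` at the isolated vertex. -/
def vertexEntry {N : ℕ} (m : ℕ) (ω : ℝ) (x : Fin N → ℤˣ) : Vertex N m → Vertex N m → ℂ
  | Sum.inl p, Sum.inl q => pathEntry m ω x p.1 q.1
  | Sum.inr _, Sum.inr _ => 1
  | Sum.inl _, Sum.inr _ => 0
  | Sum.inr _, Sum.inl _ => 0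

/-- The time-independent part of the hard Hamiltonians. -/
def hardMatrix {N : ℕ} (m : ℕ) (ω : ℝ) (x : Fin N → ℤˣ) : Matrix (Fin (dim N m)) (Fin (dim N m)) ℂ :=
  Matrix.of fun j k => vertexEntry m ω x (vertexEquiv N m j) (vertexEquiv N m k)

/-- The evolution of the superposition of the first block and the isolated vertex. -/
def vertexWave {N : ℕ} (m : ℕ) (ω : ℝ) (x : Fin N → ℤˣ) (t : ℝ) : Vertex N m → ℂ
  | Sum.inl p => (√m : ℝ)⁻¹ * pathAmp ω x t p.1
  | Sum.inr _ => Complex.exp (-Complex.I * t)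

/-- The uniform superposition of the last block. -/
def lastBlock (N m : ℕ) : Vertex N m → ℂ
  | Sum.inl p => if p.1 = Fin.last N then (√m : ℝ)⁻¹ else 0
  | Sum.inr _ => 0

theorem hardMatrix_isHermitian {N : ℕ} (m : ℕ) (ω : ℝ) (x : Fin N → ℤˣ) :
    (hardMatrix m ω x).IsHermitian := by
  ext j k
  rw [Matrix.conjTranspose_apply]
  simp only [hardMatrix, Matrix.of_apply]
  rcases vertexEquiv N m j with p | _ <;> rcases vertexEquiv N m k with q | _
  · exact star_pathEntry m ω x q.1 p.1
  all_goals simp [vertexEntry]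

theorem norm_vertexEntry_eq {N : ℕ} (m : ℕ) (ω : ℝ) (x y : Fin N → ℤˣ) (a b : Vertex N m) :
    ‖vertexEntry m ω x a b‖ = ‖vertexEntry m ω y a b‖ := by
  rcases a with p | _ <;> rcases b with q | _ <;> simp [vertexEntry, norm_pathEntry_eq m ω x y]

theorem norm_vertexEntry_le {N m : ℕ} {ω : ℝ} (hm : 0 < m) (hω : 0 ≤ ω) (hωm : N * ω ≤ m)
    (x : Fin N → ℤˣ) (a b : Vertex N m) : ‖vertexEntry m ω x a b‖ ≤ 1 := by
  rcases a with p | _ <;> rcases b with q | _ <;> simp only [vertexEntry]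
  · exact norm_pathEntry_le hm hω hωm x (Nat.lt_succ_iff.mp p.1.2) (Nat.lt_succ_iff.mp q.1.2)
  all_goals simp

theorem dependsOn_vertexEntry {N : ℕ} (m : ℕ) (ω : ℝ) (a b : Vertex N m) :
    ∃ S : Finset (Fin N), S.card ≤ 1 ∧
      DependsOn (fun x : Fin N → ℤˣ => vertexEntry m ω x a b) (S : Set (Fin N)) := by
  rcases a with p | _ <;> rcases b with q | _
  · exact dependsOn_pathEntry m ω p.1 q.1
  all_goals exact ⟨∅, by simp, fun x y _ => rfl⟩

theorem maxNorm_hardMatrix {N m : ℕ} {ω : ℝ} (hm : 0 < m) (hω : 0 ≤ ω) (hωm : N * ω ≤ m)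
    (x : Fin N → ℤˣ) {r : ℝ} (hr : 0 ≤ r) : maxNorm ((r : ℂ) • hardMatrix m ω x) = r := by
  have hle : ∀ p : Fin (dim N m) × Fin (dim N m), ‖((r : ℂ) • hardMatrix m ω x) p.1 p.2‖ ≤ r := by
    intro p
    rw [Matrix.smul_apply, norm_smul, Complex.norm_real, Real.norm_of_nonneg hr]
    exact mul_le_of_le_one_right hr (norm_vertexEntry_le hm hω hωm x _ _)
  let v := (vertexEquiv N m).symm (Sum.inr ())
  have : Nonempty (Fin (dim N m) × Fin (dim N m)) := ⟨(v, v)⟩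
  refine le_antisymm (ciSup_le hle) ?_
  refine le_trans ?_ (le_ciSup (Set.finite_range _).bddAbove (v, v))
  rw [Matrix.smul_apply, norm_smul, Complex.norm_real, Real.norm_of_nonneg hr]
  simp [hardMatrix, v, vertexEntry]

theorem card_vertexEntry_ne_zero_le {N m d : ℕ} (hd : 2 ≤ d) (hm : 2 * m ≤ d) (ω : ℝ)
    (x : Fin N → ℤˣ) (a : Vertex N m) {S : Finset (Vertex N m)}
    (hS : ∀ b ∈ S, vertexEntry m ω x a b ≠ 0) : S.card ≤ d := by
  rcases a with ⟨j, a⟩ | _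
  · have hsub : S ⊆ Finset.univ.image fun p : Bool × Fin m =>
        (Sum.inl (Fin.ofNat (N + 1) (if p.1 then j + 1 else j - 1), p.2) : Vertex N m) := by
      intro b hb
      have hne := hS b hb
      rcases b with ⟨k, b⟩ | _
      · simp only [vertexEntry, pathEntry] at hne
        simp only [Finset.mem_image, Finset.mem_univ, true_and, Prod.exists]
        by_cases h1 : (k : ℕ) = j + 1
        · refine ⟨true, b, ?_⟩
          have : Fin.ofNat (N + 1) (j + 1 : ℕ) = k := by
            rw [← h1]; ext; simp
          rw [if_pos rfl, this]
        · by_cases h2 : (j : ℕ) = k + 1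
          · refine ⟨false, b, ?_⟩
            have : Fin.ofNat (N + 1) (j - 1 : ℕ) = k := by
              rw [h2, Nat.add_sub_cancel]; ext; simp
            rw [if_neg Bool.false_ne_true, this]
          · simp [h1, h2] at hne
      · simp [vertexEntry] at hne
    refine (Finset.card_le_card hsub).trans (Finset.card_image_le.trans ?_)
    simpa using hm
  · have hsub : S ⊆ {Sum.inr ()} := by
      intro b hb
      have hne := hS b hb
      rcases b with _ | _
      · simp [vertexEntry] at hne
      · simp
    refine (Finset.card_le_card hsub).trans ?_
    simp only [Finset.card_singleton]
    omega

theorem isSparseHamiltonian_hardMatrix {N m d : ℕ} (hd : 2 ≤ d) (hm : 2 * m ≤ d) (ω T : ℝ)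
    {h : ℝ → ℝ} (hi : IntervalIntegrable h volume 0 T) (x : Fin N → ℤˣ) :
    IsSparseHamiltonian T d fun t => (h t : ℂ) • hardMatrix m ω x where
  hermitian t _ := by
    rw [Matrix.IsHermitian, Matrix.conjTranspose_smul, hardMatrix_isHermitian m ω x]
    simp
  integrable j k := by
    have : IntervalIntegrable (fun t => (h t : ℂ)) volume 0 T := ⟨hi.1.ofReal, hi.2.ofReal⟩
    exact this.mul_const _
  sparse j := by
    rw [← Finset.card_map (vertexEquiv N m).toEmbedding]
    refine card_vertexEntry_ne_zero_le hd hm ω x (vertexEquiv N m j) fun b hb => ?_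
    simp only [Finset.mem_map, rowSupport, Finset.mem_filter] at hb
    obtain ⟨k, ⟨-, t, -, hne⟩, rfl⟩ := hb
    intro h0
    apply hne
    rw [Matrix.smul_apply]
    simp only [hardMatrix, Matrix.of_apply]
    rw [show (vertexEquiv N m) k = (vertexEquiv N m).toEmbedding k from rfl, h0, smul_zero]

theorem col_hardMatrix {N m : ℕ} (ω T : ℝ) (h : ℝ → ℝ) (x y : Fin N → ℤˣ) (j : Fin (dim N m))
    (k : ℕ) : col T (fun t => (h t : ℂ) • hardMatrix m ω x) j k
      = col T (fun t => (h t : ℂ) • hardMatrix m ω y) j k := by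
  have : rowSupport T (fun t => (h t : ℂ) • hardMatrix m ω x) j
      = rowSupport T (fun t => (h t : ℂ) • hardMatrix m ω y) j := by
    ext k
    have h0 : ∀ t, ((h t : ℂ) • hardMatrix m ω x) j k ≠ 0 ↔ ((h t : ℂ) • hardMatrix m ω y) j k ≠ 0 := by
      intro t
      rw [← norm_ne_zero_iff, ← norm_ne_zero_iff (a := ((h t : ℂ) • hardMatrix m ω y) j k),
        Matrix.smul_apply, Matrix.smul_apply, norm_smul, norm_smul]
      simp only [hardMatrix, Matrix.of_apply, norm_vertexEntry_eq m ω x y]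
    simp only [rowSupport, Finset.mem_filter, h0]
  rw [col, col, this]

theorem hasDerivAt_vertexWave {N m : ℕ} (hm : 0 < m) (ω : ℝ) (x : Fin N → ℤˣ) (t : ℝ)
    (a : Vertex N m) : HasDerivAt (fun t => vertexWave m ω x t a)
      (-Complex.I * ∑ b, vertexEntry m ω x a b * vertexWave m ω x t b) t := by
  rcases a with ⟨j, a⟩ | _
  · refine ((hasDerivAt_pathAmp hm ω x t (Nat.lt_succ_iff.mp j.2)).const_mul
      (((√m : ℝ)⁻¹ : ℝ) : ℂ)).congr_deriv ?_
    rw [Fintype.sum_sum_type, Fintype.sum_prod_type]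
    simp only [vertexEntry, vertexWave, Finset.sum_const, Finset.card_univ, Fintype.card_fin,
      nsmul_eq_mul, zero_mul, mul_zero, add_zero, Finset.sum_range, Finset.mul_sum]
    refine Finset.sum_congr rfl fun k _ => ?_
    ring
  · have h : HasDerivAt (fun t : ℝ => -Complex.I * (t : ℂ)) (-Complex.I) t := by
      simpa using (Complex.ofRealCLM.hasDerivAt (x := t)).const_mul (-Complex.I)
    refine h.cexp.congr_deriv ?_
    simp [vertexEntry, vertexWave, mul_comm]

theorem timeOrderedExp_hardMatrix_mulVec {N m : ℕ} (hm : 0 < m) (ω : ℝ) {T : ℝ} (hT : 0 ≤ T)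
    {h : ℝ → ℝ} (hi : IntervalIntegrable h volume 0 T) (x : Fin N → ℤˣ) :
    (timeOrderedExp (fun t => (h t : ℂ) • hardMatrix m ω x) T).mulVec
        (vertexWave m ω x 0 ∘ vertexEquiv N m)
      = vertexWave m ω x (∫ s in (0 : ℝ)..T, h s) ∘ vertexEquiv N m := by
  refine timeOrderedExp_mulVec_eq hT hi (hardMatrix m ω x)
    (fun t => vertexWave m ω x t ∘ vertexEquiv N m) fun t i => ?_
  refine (hasDerivAt_vertexWave hm ω x t (vertexEquiv N m i)).congr_deriv ?_
  rw [← Equiv.sum_comp (vertexEquiv N m)]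
  rfl

theorem vertexWave_zero {N : ℕ} (m : ℕ) (ω : ℝ) (x y : Fin N → ℤˣ) :
    vertexWave m ω x 0 = vertexWave m ω y 0 := by
  ext a
  rcases a with ⟨j, a⟩ | _
  · rcases Nat.eq_zero_or_pos (j : ℕ) with hj | hj
    · simp [vertexWave, pathAmp, hj]
    · simp [vertexWave, pathAmp, spinAmp, hj.ne']
  · rfl

theorem norm_toLp_comp_vertexEquiv {N m : ℕ} (u : Vertex N m → ℂ) :
    ‖WithLp.toLp 2 (u ∘ vertexEquiv N m)‖ = √(∑ a, ‖u a‖ ^ 2) := by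
  rw [EuclideanSpace.norm_eq, ← Equiv.sum_comp (vertexEquiv N m)]
  rfl

theorem inv_sqrt_mul_self {m : ℕ} (hm : 0 < m) : (m : ℝ) * ((√(m : ℝ))⁻¹ * (√(m : ℝ))⁻¹) = 1 := by
  have hm' : (0 : ℝ) < m := by exact_mod_cast hm
  rw [← mul_inv, Real.mul_self_sqrt hm'.le, mul_inv_cancel₀ hm'.ne']

theorem norm_vertexWave_zero {N m : ℕ} (hm : 0 < m) (ω : ℝ) (x : Fin N → ℤˣ) :
    ‖WithLp.toLp 2 (vertexWave m ω x 0 ∘ vertexEquiv N m)‖ = √2 := by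
  rw [norm_toLp_comp_vertexEquiv, Fintype.sum_sum_type, Fintype.sum_prod_type, Fin.sum_univ_succ]
  have h1 : ∑ j : Fin N, ∑ a : Fin m, ‖vertexWave m ω x 0 (Sum.inl (j.succ, a))‖ ^ 2 = 0 := by
    refine Finset.sum_eq_zero fun j _ => Finset.sum_eq_zero fun a _ => ?_
    simp [vertexWave, pathAmp, spinAmp]
  have h2 : ∑ a : Fin m, ‖vertexWave m ω x 0 (Sum.inl (0, a))‖ ^ 2 = 1 := by
    have : ∀ a : Fin m, ‖vertexWave m ω x 0 (Sum.inl (0, a))‖ ^ 2 = (m : ℝ)⁻¹ := by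
      intro a
      simp [vertexWave, pathAmp, spinAmp]
    simp only [this, Finset.sum_const, Finset.card_univ, Fintype.card_fin, nsmul_eq_mul]
    exact mul_inv_cancel₀ (by exact_mod_cast hm.ne')
  rw [h1, h2]
  congr 1
  simp [vertexWave]
  norm_num

theorem norm_isolated (N m : ℕ) :
    ‖WithLp.toLp 2 ((Pi.single (Sum.inr ()) 1 : Vertex N m → ℂ) ∘ vertexEquiv N m)‖ = 1 := by
  rw [norm_toLp_comp_vertexEquiv, Fintype.sum_sum_type]
  simp

theorem norm_lastBlock {N m : ℕ} (hm : 0 < m) :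
    ‖WithLp.toLp 2 (lastBlock N m ∘ vertexEquiv N m)‖ = 1 := by
  rw [norm_toLp_comp_vertexEquiv, Fintype.sum_sum_type, Fintype.sum_prod_type,
    Finset.sum_eq_single (Fin.last N)]
  · have : ∀ a : Fin m, ‖lastBlock N m (Sum.inl (Fin.last N, a))‖ ^ 2 = (m : ℝ)⁻¹ := by
      intro a
      simp [lastBlock]
    simp only [this, Finset.sum_const, Finset.card_univ, Fintype.card_fin, nsmul_eq_mul]
    rw [mul_inv_cancel₀ (by exact_mod_cast hm.ne')]
    simp [lastBlock]
  · intro j _ hj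
    simp [lastBlock, hj]
  · simp

theorem sum_lastBlock_mul_vertexWave {N m : ℕ} (hm : 0 < m) (ω t : ℝ) (x : Fin N → ℤˣ) :
    ∑ a, star (lastBlock N m a) * vertexWave m ω x t a
      = (∏ i, ((x i : ℤ) : ℂ)) * (-Complex.I * (Real.sin (ω * t) : ℂ)) ^ N := by
  rw [Fintype.sum_sum_type, Fintype.sum_prod_type, Finset.sum_eq_single (Fin.last N)]
  · have := congrArg (fun r : ℝ => (r : ℂ)) (inv_sqrt_mul_self hm)
    push_cast at this
    simp [lastBlock, vertexWave, pathAmp, spinAmp, prod_range_signAt]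
    linear_combination (∏ i, ((x i : ℤ) : ℂ)) * (-(Complex.I * Complex.sin (ω * t))) ^ N * this
  · intro j _ hj
    simp [lastBlock, hj]
  · simp

/-- A simulation of all signed blown-up paths of length `N` needs `N / 2` queries, unless the
amplitude at the far end is of the order of the precision. -/
theorem le_two_mul_queries {N m d : ℕ} {ε T ω : ℝ} {h : ℝ → ℝ} (hε : 0 < ε) (hε' : ε ≤ 1 / 16)
    (hT : 0 ≤ T) (hi : IntervalIntegrable h volume 0 T) (hm : 0 < m)
    (hamp : 4 * ε < |Real.sin (ω * ∫ s in (0 : ℝ)..T, h s)| ^ N)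
    (𝒜 : QueryAlgorithm (dim N m) d T)
    (hsim : ∀ x : Fin N → ℤˣ, 𝒜.Simulates (fun t => (h t : ℂ) • hardMatrix m ω x) ε) :
    N ≤ 2 * 𝒜.queries := by
  by_contra! hq
  refine hamp.not_ge ?_
  set τ := ∫ s in (0 : ℝ)..T, h s with hτ
  have hnorm : ‖(-Complex.I * (Real.sin (ω * τ) : ℂ)) ^ N‖ = |Real.sin (ω * τ)| ^ N := by
    rw [norm_pow, norm_mul, norm_neg, Complex.norm_I, one_mul, Complex.norm_real, Real.norm_eq_abs]
  rw [← hnorm]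
  have hsumcomp : ∀ (u v : Vertex N m → ℂ),
      ∑ i, star ((u ∘ vertexEquiv N m) i) * (v ∘ vertexEquiv N m) i = ∑ a, star (u a) * v a :=
    fun u v => Equiv.sum_comp (vertexEquiv N m) fun a => star (u a) * v a
  have hev : ∀ x : Fin N → ℤˣ, (timeOrderedExp (fun t => (h t : ℂ) • hardMatrix m ω x) T).mulVec
      (vertexWave m ω (1 : Fin N → ℤˣ) 0 ∘ vertexEquiv N m)
        = vertexWave m ω x τ ∘ vertexEquiv N m := by
    intro x
    rw [vertexWave_zero m ω 1 x]
    exact timeOrderedExp_hardMatrix_mulVec hm ω hT hi x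
  refine norm_amplitude_le hε hε' 𝒜 (fun x t => (h t : ℂ) • hardMatrix m ω x)
    (fun x y j k => col_hardMatrix ω T h x y j k) (fun j k => ?_) hsim
    (norm_vertexWave_zero hm ω (1 : Fin N → ℤˣ)) (norm_isolated N m) (norm_lastBlock hm)
    (w := Complex.exp (-Complex.I * τ)) ?_ ?_ (fun x => ?_) (fun x => ?_) hq
  · obtain ⟨S, hS, hd⟩ := dependsOn_vertexEntry m ω (vertexEquiv N m j) (vertexEquiv N m k)
    exact ⟨S, hS, fun t _ x y hxy => congrArg (fun z : ℂ => (h t : ℂ) * z) (hd hxy)⟩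
  · rw [Complex.norm_exp]; simp
  · rw [hnorm]; exact pow_le_one₀ (abs_nonneg _) (Real.abs_sin_le_one _)
  · rw [hev, hsumcomp, Finset.sum_eq_single (Sum.inr ())]
    · simp [vertexWave]
    · intro b _ hb
      simp [hb]
    · simp
  · rw [hev, hsumcomp, sum_lastBlock_mul_vertexWave hm]

theorem exists_hard_family {ε T φ : ℝ} {d N : ℕ} {h : ℝ → ℝ} (hε : 0 < ε) (hε' : ε ≤ 1 / 16)
    (hT : 0 < T) (hd : 2 ≤ d) (h0 : ∀ t ∈ Set.Icc (0 : ℝ) T, 0 ≤ h t)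
    (hi : IntervalIntegrable h volume 0 T) (hτ : 0 < ∫ τ in (0 : ℝ)..T, h τ) (hφ : 0 ≤ φ)
    (hN : N * φ ≤ (d * ∫ τ in (0 : ℝ)..T, h τ) / 3) (hamp : 4 * ε < |Real.sin φ| ^ N) :
    ∃ (n : ℕ) (𝓗 : Set (ℝ → Matrix (Fin n) (Fin n) ℂ)),
      (∀ H ∈ 𝓗, IsSparseHamiltonian T d H ∧
        (∀ t ∈ Set.Icc (0 : ℝ) T, maxNorm (H t) = h t) ∧
        ∃ G : Matrix (Fin n) (Fin n) ℂ, ∀ t ∈ Set.Icc (0 : ℝ) T, H t = (h t : ℂ) • G) ∧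
      ∀ 𝒜 : QueryAlgorithm n d T, (∀ H ∈ 𝓗, 𝒜.Simulates H ε) → N ≤ 2 * 𝒜.queries := by
  set τ := ∫ s in (0 : ℝ)..T, h s with hτdef
  obtain ⟨m, hm⟩ : ∃ m, m = d / 2 := ⟨_, rfl⟩
  have hm0 : 0 < m := by omega
  have hmd : (d : ℝ) ≤ 3 * m := by
    have : d ≤ 3 * m := by omega
    exact_mod_cast this
  have hω : N * (φ / τ) ≤ m := by
    rw [← mul_div_assoc, div_le_iff₀ hτ]
    nlinarith
  have hωτ : φ / τ * τ = φ := div_mul_cancel₀ φ hτ.ne'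
  refine ⟨dim N m, Set.range fun (x : Fin N → ℤˣ) t => (h t : ℂ) • hardMatrix m (φ / τ) x, ?_, ?_⟩
  · rintro _ ⟨x, rfl⟩
    exact ⟨isSparseHamiltonian_hardMatrix hd (by omega) _ T hi x,
      fun t ht => maxNorm_hardMatrix hm0 (by positivity) hω x (h0 t ht), _, fun t _ => rfl⟩
  · intro 𝒜 hsim
    exact le_two_mul_queries hε hε' hT.le hi hm0 (by rwa [← hτdef, hωτ]) 𝒜
      fun x => hsim _ ⟨x, rfl⟩

theorem half_le_natFloor {y : ℝ} (hy : 1 ≤ y) : y / 2 ≤ (⌊y⌋₊ : ℝ) := by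
  have h1 : (1 : ℝ) ≤ ⌊y⌋₊ := by exact_mod_cast (Nat.one_le_floor_iff y).mpr hy
  have h2 := Nat.lt_floor_add_one y
  linarith

theorem exp_one_lt_log_inv {ε : ℝ} (hε : 0 < ε) (hε' : ε ≤ 1 / 16) :
    Real.exp 1 < Real.log (1 / ε) := by
  have h16 : Real.log 16 = 4 * Real.log 2 := by
    rw [show (16 : ℝ) = 2 ^ 4 by norm_num, Real.log_pow]; norm_num
  have h1 : Real.log 16 ≤ Real.log (1 / ε) := by
    refine Real.log_le_log (by norm_num) ?_
    rw [le_div_iff₀ hε]; linarith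
  have h2 := Real.log_two_gt_d9
  have h3 := Real.exp_one_lt_d9
  norm_num at h2 h3
  linarith

theorem four_mul_lt_sin_min {ε M : ℝ} (hε : 0 < ε) (hε' : ε ≤ 1 / 16) (hM : 16 * ε ≤ M) :
    4 * ε < Real.sin (min (M / 3) 1) := by
  have hpos : 0 < min (M / 3) 1 := lt_min (by linarith) one_pos
  have hle : min (M / 3) 1 ≤ 1 := min_le_right _ _
  have hlow : 16 / 3 * ε ≤ min (M / 3) 1 := le_min (by linarith) (by linarith)
  have hsin := Real.sin_gt_sub_cube hpos
  nlinarith [mul_nonneg hpos.le (sub_nonneg.mpr (pow_le_one₀ (n := 2) hpos.le hle))]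

theorem four_mul_lt_sin_min_pow {A ε M : ℝ} {N : ℕ} (hA : 0 < A) (hε : 0 < ε) (hε' : ε ≤ 1 / 16)
    (hM : Real.log (1 / ε) ^ (-A) ≤ M) (hN : 1 ≤ N)
    (hNL : 6 * (A + 1) * N * Real.log (Real.log (1 / ε)) ≤ Real.log (1 / ε)) :
    4 * ε < |Real.sin (min (M / (3 * N)) 1)| ^ N := by
  have hLe := exp_one_lt_log_inv hε hε'
  have hexpL : Real.exp (-Real.log (1 / ε)) = ε := by
    rw [one_div, Real.log_inv, neg_neg, Real.exp_log hε]
  set L := Real.log (1 / ε)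
  have he := Real.add_one_le_exp (1 : ℝ)
  have hL0 : 0 < L := (Real.exp_pos 1).trans hLe
  have hLL : 1 < Real.log L := by rwa [Real.lt_log_iff_exp_lt hL0]
  have hN1 : (1 : ℝ) ≤ N := by exact_mod_cast hN
  have h6N : 6 * N ≤ L := by
    have h1 : (6 : ℝ) * N * 1 ≤ 6 * (A + 1) * N * Real.log L := by
      refine mul_le_mul ?_ hLL.le zero_le_one (by positivity)
      nlinarith
    linarith
  set φ := min (M / (3 * N)) 1
  have hLA : L ^ (-(A + 1)) = L ^ (-A) / L := by
    rw [neg_add, ← sub_eq_add_neg, Real.rpow_sub_one hL0.ne']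
  have hLA0 : 0 < L ^ (-A) := Real.rpow_pos_of_pos hL0 _
  have hLA1 : L ^ (-A) ≤ 1 := Real.rpow_le_one_of_one_le_of_nonpos (by linarith) (by linarith)
  have hφ2 : L ^ (-(A + 1)) ≤ φ / 2 := by
    rw [hLA, le_div_iff₀ two_pos]
    refine le_min ?_ ?_
    · rw [div_mul_eq_mul_div, div_le_div_iff₀ hL0 (by positivity)]
      nlinarith [mul_le_mul_of_nonneg_left h6N hLA0.le]
    · rw [div_mul_eq_mul_div, div_le_one hL0]
      linarith
  have hφ0 : 0 ≤ φ := by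
    have := Real.rpow_pos_of_pos hL0 (-(A + 1))
    linarith
  have hφ1 : φ ≤ 1 := min_le_right _ _
  have hsin : φ / 2 ≤ Real.sin φ := by
    rcases hφ0.eq_or_lt with h | h
    · simp [← h]
    · have := Real.sin_gt_sub_cube h
      nlinarith [mul_nonneg h.le (sub_nonneg.mpr (pow_le_one₀ (n := 2) h.le hφ1))]
  have hexp : Real.exp (-L / 6) ≤ |Real.sin φ| ^ N := by
    calc Real.exp (-L / 6) ≤ Real.exp (N * (Real.log L * (-(A + 1)))) := by
          apply Real.exp_le_exp.mpr; linarith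
      _ = (L ^ (-(A + 1))) ^ N := by rw [Real.exp_nat_mul, Real.rpow_def_of_pos hL0]
      _ ≤ |Real.sin φ| ^ N := by
          refine pow_le_pow_left₀ (by positivity) ?_ N
          exact hφ2.trans (hsin.trans (le_abs_self _))
  refine lt_of_lt_of_le ?_ hexp
  have hsq : Real.exp (-L / 2) * Real.exp (-L / 2) = ε := by
    rw [← Real.exp_add, ← hexpL]; congr 1; ring
  have hlt : Real.exp (-L / 2) < Real.exp (-L / 6) := Real.exp_lt_exp.mpr (by linarith)
  have hq : Real.exp (-L / 2) ≤ 1 / 4 := by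
    by_contra! h
    nlinarith
  nlinarith [Real.exp_pos (-L / 2)]

theorem exists_length_and_angle {A : ℝ} (hA : 0 < A) : ∃ c : ℝ, 0 < c ∧ ∀ ε M : ℝ, 0 < ε →
    ε ≤ 1 / 16 → 16 * ε ≤ M → Real.log (1 / ε) ^ (-A) ≤ M →
    ∃ (N : ℕ) (φ : ℝ), 0 ≤ φ ∧ N * φ ≤ M / 3 ∧ 4 * ε < |Real.sin φ| ^ N ∧
      c * (M + Real.log (1 / ε) / Real.log (Real.log (1 / ε))) ≤ N / 2 := by
  set κ : ℝ := 1 / (6 * (A + 1)) with hκ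
  have hκ0 : 0 < κ := by positivity
  have hκ6 : κ ≤ 1 / 6 := by
    rw [hκ]; exact one_div_le_one_div_of_le (by norm_num) (by linarith)
  refine ⟨κ / 8, by positivity, fun ε M hε hε' hM hMA => ?_⟩
  have hLe := exp_one_lt_log_inv hε hε'
  have hL0 : 0 < Real.log (1 / ε) := (Real.exp_pos 1).trans hLe
  have hLL : 1 < Real.log (Real.log (1 / ε)) := by rwa [Real.lt_log_iff_exp_lt hL0]
  set L := Real.log (1 / ε)
  set X := L / Real.log L with hX
  have hX0 : 0 < X := by positivity
  have hM0 : 0 < M := by linarith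
  have single : M + X ≤ 4 / κ → ∃ (N : ℕ) (φ : ℝ), 0 ≤ φ ∧ N * φ ≤ M / 3 ∧
      4 * ε < |Real.sin φ| ^ N ∧ κ / 8 * (M + X) ≤ N / 2 := by
    intro h
    refine ⟨1, min (M / 3) 1, by positivity, by simp, ?_, ?_⟩
    · rw [pow_one]
      exact (four_mul_lt_sin_min hε hε' hM).trans_le (le_abs_self _)
    · rw [le_div_iff₀ hκ0] at h
      push_cast
      linarith
  rcases le_or_gt X M with hXM | hXM
  · rcases le_or_gt 5 M with h5 | h5
    · have hpi := Real.pi_lt_d2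
      have hpi0 := Real.pi_pos
      have hy : 1 ≤ 2 * M / (3 * Real.pi) := by
        rw [le_div_iff₀ (by positivity)]; linarith
      have hfl := half_le_natFloor hy
      have hfl' := Nat.floor_le (zero_le_one.trans hy)
      refine ⟨⌊2 * M / (3 * Real.pi)⌋₊, Real.pi / 2, by positivity, ?_, ?_, ?_⟩
      · calc (⌊2 * M / (3 * Real.pi)⌋₊ : ℝ) * (Real.pi / 2)
            ≤ 2 * M / (3 * Real.pi) * (Real.pi / 2) := by gcongr
          _ = M / 3 := by field_simp
      · rw [Real.sin_pi_div_two]; simp; linarith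
      · have h1 : M / 10 ≤ 2 * M / (3 * Real.pi) / 2 := by
          rw [div_div, div_le_div_iff₀ (by norm_num) (by positivity)]
          nlinarith
        nlinarith
    · refine single ?_
      rw [le_div_iff₀ hκ0]
      nlinarith
  · rcases le_or_gt 1 (κ * X) with h1 | h1
    · have hfl := half_le_natFloor h1
      have hfl' := Nat.floor_le (zero_le_one.trans h1)
      have hN : 1 ≤ ⌊κ * X⌋₊ := (Nat.one_le_floor_iff _).mpr h1
      have hN0 : (0 : ℝ) < ⌊κ * X⌋₊ := by exact_mod_cast hN
      refine ⟨⌊κ * X⌋₊, min (M / (3 * ⌊κ * X⌋₊)) 1, by positivity, ?_,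
        four_mul_lt_sin_min_pow hA hε hε' hMA hN ?_, ?_⟩
      · calc (⌊κ * X⌋₊ : ℝ) * min (M / (3 * ⌊κ * X⌋₊)) 1
            ≤ ⌊κ * X⌋₊ * (M / (3 * ⌊κ * X⌋₊)) := by gcongr; exact min_le_left _ _
          _ = M / 3 := by field_simp
      · calc 6 * (A + 1) * (⌊κ * X⌋₊ : ℝ) * Real.log L
            ≤ 6 * (A + 1) * (κ * X) * Real.log L := by gcongr
          _ = L := by
            have : Real.log L ≠ 0 := by positivity
            rw [hκ, hX]; field_simp
      · nlinarith
    · refine single ?_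
      rw [le_div_iff₀ hκ0]
      nlinarith

end HamSim

end

theorem mainTheorem3 :
    ∀ A : ℝ, 0 < A → ∃ c : ℝ, 0 < c ∧
      ∀ (ε T : ℝ) (d : ℕ) (h : ℝ → ℝ), 0 < ε → ε ≤ 1 / 16 → 0 < T → 2 ≤ d →
        (∀ t ∈ Set.Icc (0 : ℝ) T, 0 ≤ h t) → IntervalIntegrable h volume 0 T →
        16 * ε ≤ d * ∫ τ in (0 : ℝ)..T, h τ →
        Real.log (1 / ε) ^ (-A) ≤ d * ∫ τ in (0 : ℝ)..T, h τ →
        ∃ (n : ℕ) (𝓗 : Set (ℝ → Matrix (Fin n) (Fin n) ℂ)),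
          (∀ H ∈ 𝓗, HamSim.IsSparseHamiltonian T d H ∧
            (∀ t ∈ Set.Icc (0 : ℝ) T, HamSim.maxNorm (H t) = h t) ∧
            ∃ G : Matrix (Fin n) (Fin n) ℂ, ∀ t ∈ Set.Icc (0 : ℝ) T, H t = (h t : ℂ) • G) ∧
          ∀ 𝒜 : HamSim.QueryAlgorithm n d T, (∀ H ∈ 𝓗, 𝒜.Simulates H ε) →
            c * (d * (∫ τ in (0 : ℝ)..T, h τ) +
              Real.log (1 / ε) / Real.log (Real.log (1 / ε))) ≤ (𝒜.queries : ℝ) := by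
  intro A hA
  obtain ⟨c, hc, hchoice⟩ := HamSim.exists_length_and_angle hA
  refine ⟨c, hc, fun ε T d h hε hε' hT hd h0 hi hM hMA => ?_⟩
  obtain ⟨N, φ, hφ, hN, hamp, hcN⟩ := hchoice ε _ hε hε' hM hMA
  have hτ : 0 < ∫ τ in (0 : ℝ)..T, h τ :=
    pos_of_mul_pos_right (lt_of_lt_of_le (by linarith) hM) d.cast_nonneg
  obtain ⟨n, 𝓗, hH, hq⟩ := HamSim.exists_hard_family hε hε' hT hd h0 hi hτ hφ hN hamp
  refine ⟨n, 𝓗, hH, fun 𝒜 hsim => hcN.trans ?_⟩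
  have : (N : ℝ) ≤ 2 * 𝒜.queries := by exact_mod_cast hq 𝒜 hsim
  linarith
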